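/- Let $I=[0,1]$ and let $a\in L^1(I)$ be real-valued. Let $W^{2,1}(I)$ be the space of $C^1$ functions $u$ on $I$ whose derivative $u'$ is absolutely continuous. For $\lambda\in\mathbb R$ put $L[\lambda]u=u''+(a+\lambda)u$, and consider the Neumann conditions $u'(0)=u'(1)=0$ and the Dirichlet conditions $u(0)=u(1)=0$. An eigenvalue is a number $\lambda$ for which $L[\lambda]u=0$ a.e. on $I$ has a solution $u\in W^{2,1}(I)$, $u\not\equiv0$, satisfying the boundary conditions. A Green's function of $L[\lambda]$ under either boundary condition is a function $G:I\times I\to\mathbb R$ such that: 1. $G$ is continuous on $I\times I$ and of class $C^1$ on $(I\times I)\setminus\{(s,s):s\in I\}$; 2. for each $s\in(0,1)$, $G(\cdot,s)$ satisfies the boundary conditions, lies in $W^{2,1}$ of every compact subinterval (of positive length) of $[0,s)$ and of $(s,1]$, and satisfies $L[\lambda]G(\cdot,s)=0$ a.e. on $[0,s)\cup(s,1]$; 3. for each $t\in(0,1)$ the lateral limits $\frac{\partial G}{\partial t}(t^-,t)=\frac{\partial G}{\partial t}(t,t^+)$ and $\frac{\partial G}{\partial t}(t^+,t)=\frac{\partial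 G}{\partial t}(t,t^-)$ exist, with the stated equalities, and $\frac{\partial G}{\partial t}(t^+,t)-\frac{\partial G}{\partial t}(t^-,t)=1$. Then the Neumann problem has a smallest real eigenvalue $\lambda_0^N$, and for every $\lambda<\lambda_0^N$ the Neumann and the Dirichlet problems for $L[\lambda]$ have unique Green's functions $G_N[\lambda]$ and $G_D[\lambda]$ on $I\times I$, and $$G_N[\lambda](t,s)<G_D[\lambda](t,s)<0\qquad\text{for all }(t,s)\in(0,1)\times(0,1).$$ -/

import Mathlib

open Set Filter Topology MeasureTheory

namespace HillGreen

/-- The Sobolev space `W^{2,1}([p, q])`: functions that are differentiable on `[p, q]` (one-sidedly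
at the endpoints) and whose derivative is absolutely continuous on `[p, q]`. Only the values of `u`
on `[p, q]` matter. -/
def MemW21 (p q : ℝ) (u : ℝ → ℝ) : Prop :=
  DifferentiableOn ℝ u (Icc p q) ∧
    AbsolutelyContinuousOnInterval (derivWithin u (Icc p q)) p q

/-- `u ∈ W^{2,1}([p, q])` solves `u''(t) + (a(t) + lam) u(t) = 0` for almost every `t ∈ [p, q]`.
The derivative `u'` is absolutely continuous, hence differentiable almost everywhere, so that
`u''` is a genuine derivative for almost every `t`. -/
def SolvesHomogeneous (a : ℝ → ℝ) (lam p q : ℝ) (u : ℝ → ℝ) : Prop :=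
  MemW21 p q u ∧
    ∀ᵐ t ∂(volume.restrict (Icc p q)),
      deriv (derivWithin u (Icc p q)) t + (a t + lam) * u t = 0

/-- Neumann conditions `u'(0) = u'(1) = 0` (one-sided derivatives). -/
def NeumannBC (u : ℝ → ℝ) : Prop :=
  derivWithin u (Icc 0 1) 0 = 0 ∧ derivWithin u (Icc 0 1) 1 = 0

/-- Dirichlet conditions `u(0) = u(1) = 0`. -/
def DirichletBC (u : ℝ → ℝ) : Prop :=
  u 0 = 0 ∧ u 1 = 0

/-- The (real) eigenvalues of `u'' + (a + mu) u = 0` on `[0, 1]` under the boundary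
conditions `B`: those `mu` for which a solution that is not identically zero exists. -/
def eigenvalues (a : ℝ → ℝ) (B : (ℝ → ℝ) → Prop) : Set ℝ :=
  {mu | ∃ u : ℝ → ℝ, SolvesHomogeneous a mu 0 1 u ∧ B u ∧ ∃ t ∈ Icc (0 : ℝ) 1, u t ≠ 0}

/-- The partial derivative `∂G/∂t (t, s)` of a function on the square `[0, 1] × [0, 1]`. -/
noncomputable def partialT (G : ℝ → ℝ → ℝ) (t s : ℝ) : ℝ :=
  derivWithin (fun x => G x s) (Icc 0 1) t

/-- `G` is a Green's function on `[0, 1] × [0, 1]` for the operator `u'' + (a + lam) u` under the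
homogeneous boundary conditions `B`. Only the values of `G` on the square matter. -/
structure IsGreenFunction (a : ℝ → ℝ) (lam : ℝ) (B : (ℝ → ℝ) → Prop) (G : ℝ → ℝ → ℝ) :
    Prop where
  /-- `G` is continuous on the square. -/
  continuousOn : ContinuousOn (fun p : ℝ × ℝ => G p.1 p.2) (Icc 0 1 ×ˢ Icc 0 1)
  /-- `G` is continuously differentiable on the square away from the diagonal. -/
  contDiffOn : ContDiffOn ℝ 1 (fun p : ℝ × ℝ => G p.1 p.2)
    {p : ℝ × ℝ | p ∈ Icc (0 : ℝ) 1 ×ˢ Icc (0 : ℝ) 1 ∧ p.1 ≠ p.2}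
  /-- `G(·, s)` solves the equation on `[0, s)`, i.e. on each compact `[0, q]` in it. -/
  solves_left : ∀ s ∈ Ioo (0 : ℝ) 1, ∀ q ∈ Ioo 0 s,
    SolvesHomogeneous a lam 0 q (fun t => G t s)
  /-- `G(·, s)` solves the equation on `(s, 1]`, i.e. on each compact `[p, 1]` in it. -/
  solves_right : ∀ s ∈ Ioo (0 : ℝ) 1, ∀ p ∈ Ioo s 1,
    SolvesHomogeneous a lam p 1 (fun t => G t s)
  /-- `G(·, s)` satisfies the boundary conditions. -/
  boundary : ∀ s ∈ Ioo (0 : ℝ) 1, B (fun t => G t s)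
  /-- The lateral limits `∂G/∂t(t⁻, t) = ∂G/∂t(t, t⁺)` and `∂G/∂t(t⁺, t) = ∂G/∂t(t, t⁻)` exist,
  and the jump of `∂G/∂t` across the diagonal is `1`. -/
  jump : ∀ t ∈ Ioo (0 : ℝ) 1, ∃ l r : ℝ,
    Tendsto (fun x => partialT G x t) (𝓝[<] t) (𝓝 l) ∧
    Tendsto (fun s => partialT G t s) (𝓝[>] t) (𝓝 l) ∧
    Tendsto (fun x => partialT G x t) (𝓝[>] t) (𝓝 r) ∧
    Tendsto (fun s => partialT G t s) (𝓝[<] t) (𝓝 r) ∧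
    r - l = 1

/-- `G` is the unique Green's function, where uniqueness is that of its values on the square. -/
def IsUniqueGreenFunction (a : ℝ → ℝ) (lam : ℝ) (B : (ℝ → ℝ) → Prop) (G : ℝ → ℝ → ℝ) : Prop :=
  IsGreenFunction a lam B G ∧
    ∀ H : ℝ → ℝ → ℝ, IsGreenFunction a lam B H →
      ∀ t ∈ Icc (0 : ℝ) 1, ∀ s ∈ Icc (0 : ℝ) 1, H t s = G t s

end HillGreen

/-! As `a` is only integrable, the equation is rewritten with the quasi-derivative `v = y' + B y`,
where `B` is the primitive of `a`. Then `(y, v)` solves a linear system with continuous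
coefficients, and the Wronskian, which is the same for derivatives and quasi-derivatives, is
differentiable everywhere with derivative `(q₁ - q₂) y₁ y₂`. Solutions in the two senses agree
(`SysOn.solvesHomogeneous`, `SolvesHomogeneous.sysOn`).

The smallest Neumann eigenvalue is the supremum `mu` of the parameters whose solution with `y 0 =
1`, `y' 0 = 0` is positive on `[0, 1]` with `y' 1 > 0` (`exists_principal`). Sturm comparison with
an explicit positive function having Neumann data shows that such parameters exist and are bounded
above. At `mu` the solution is still positive and `y' 1 = 0`.

For `lam < mu`, comparison gives positive solutions `φ`, `ψ` with Neumann data at `0` and at `1`,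
with constant Wronskian `W < 0` and `ψ / φ` strictly decreasing (`exists_positive_pair`).
Independence of `φ` and `ψ` excludes eigenvalues below `mu`. The Neumann kernel is `φ(min) ψ(max) /
W`. Subtracting multiples gives `P = φ - α ψ` with `P 0 = 0` and `Q = ψ - β φ` with `Q 1 = 0`,
positive elsewhere by monotonicity of `ψ / φ`, and the Dirichlet kernel `P(min) Q(max) / (W (1 - α
β))`, which is negative. The comparison of the kernels is the identity `(1 - α β) φ(t) ψ(s) - P(t)
Q(s) = β φ(t) P(s) + α ψ(t) Q(s)`, whose right side is positive. -/

namespace HillGreen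

/-! ### Quasi-derivative system and Wronskian identities. -/

/-- The regularised first-order system for `y'' + (B' + q) y = 0` in terms of `y` and its
quasi-derivative `v = y' + B y`. -/
def SysOn (B q : ℝ → ℝ) (p r : ℝ) (y v : ℝ → ℝ) : Prop :=
  ∀ t ∈ Icc p r, HasDerivWithinAt y (v t - B t * y t) (Icc p r) t ∧
    HasDerivWithinAt v (B t * v t - (B t ^ 2 + q t) * y t) (Icc p r) t

/-- The Wronskian of two pairs (function, quasi-derivative). -/
def wr (y₁ v₁ y₂ v₂ : ℝ → ℝ) (t : ℝ) : ℝ := y₁ t * v₂ t - v₁ t * y₂ t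

namespace SysOn

variable {B q q₁ q₂ y v y₁ v₁ y₂ v₂ : ℝ → ℝ} {p r p' r' : ℝ}

theorem mono (h : SysOn B q p r y v) (hs : Icc p' r' ⊆ Icc p r) : SysOn B q p' r' y v :=
  fun t ht => ⟨(h t (hs ht)).1.mono hs, (h t (hs ht)).2.mono hs⟩

theorem continuousOn_fst (h : SysOn B q p r y v) : ContinuousOn y (Icc p r) :=
  fun t ht => (h t ht).1.continuousWithinAt

theorem continuousOn_snd (h : SysOn B q p r y v) : ContinuousOn v (Icc p r) :=
  fun t ht => (h t ht).2.continuousWithinAt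

theorem linComb (h₁ : SysOn B q p r y₁ v₁) (h₂ : SysOn B q p r y₂ v₂) (c d : ℝ) :
    SysOn B q p r (fun t => c * y₁ t + d * y₂ t) (fun t => c * v₁ t + d * v₂ t) := by
  intro t ht
  refine ⟨(((h₁ t ht).1.const_mul c).add ((h₂ t ht).1.const_mul d)).congr_deriv ?_,
    (((h₁ t ht).2.const_mul c).add ((h₂ t ht).2.const_mul d)).congr_deriv ?_⟩ <;> ring

/-- All terms containing `B` cancel, so the regularised system has the classical Wronskian identity
at every point. -/
theorem hasDerivWithinAt_wr (h₁ : SysOn B q₁ p r y₁ v₁) (h₂ : SysOn B q₂ p r y₂ v₂) {t : ℝ}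
    (ht : t ∈ Icc p r) :
    HasDerivWithinAt (wr y₁ v₁ y₂ v₂) ((q₁ t - q₂ t) * (y₁ t * y₂ t)) (Icc p r) t := by
  refine (((h₁ t ht).1.mul (h₂ t ht).2).sub ((h₁ t ht).2.mul (h₂ t ht).1)).congr_deriv ?_
  ring

theorem continuousOn_wr (h₁ : SysOn B q₁ p r y₁ v₁) (h₂ : SysOn B q₂ p r y₂ v₂) :
    ContinuousOn (wr y₁ v₁ y₂ v₂) (Icc p r) :=
  fun _ ht => (hasDerivWithinAt_wr h₁ h₂ ht).continuousWithinAt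

theorem hasDerivWithinAt_div (h₁ : SysOn B q₁ p r y₁ v₁) (h₂ : SysOn B q₂ p r y₂ v₂) {t : ℝ}
    (ht : t ∈ Icc p r) (h0 : y₁ t ≠ 0) :
    HasDerivWithinAt (fun t => y₂ t / y₁ t) (wr y₁ v₁ y₂ v₂ t / y₁ t ^ 2) (Icc p r) t := by
  refine ((h₂ t ht).1.div (h₁ t ht).1 h0).congr_deriv ?_
  rw [wr]; congr 1; ring

theorem wr_eq_left (h₁ : SysOn B q p r y₁ v₁) (h₂ : SysOn B q p r y₂ v₂) {t : ℝ}
    (ht : t ∈ Icc p r) : wr y₁ v₁ y₂ v₂ t = wr y₁ v₁ y₂ v₂ p := by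
  refine constant_of_has_deriv_right_zero (continuousOn_wr h₁ h₂) (fun x hx => ?_) t ht
  have := hasDerivWithinAt_wr h₁ h₂ (Ico_subset_Icc_self hx)
  rw [sub_self, zero_mul] at this
  exact this.mono_of_mem_nhdsWithin (Icc_mem_nhdsGE_of_mem hx)

theorem wr_eq (h₁ : SysOn B q p r y₁ v₁) (h₂ : SysOn B q p r y₂ v₂) {s t : ℝ}
    (hs : s ∈ Icc p r) (ht : t ∈ Icc p r) : wr y₁ v₁ y₂ v₂ s = wr y₁ v₁ y₂ v₂ t :=
  (wr_eq_left h₁ h₂ hs).trans (wr_eq_left h₁ h₂ ht).symm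

end SysOn

/-! ### Growth bound and truncation of the vector field. -/

section Field

/-- The right-hand side of the system, as a linear function of the state. -/
def field (b c : ℝ) (x : ℝ × ℝ) : ℝ × ℝ := (x.2 - b * x.1, b * x.2 - (b ^ 2 + c) * x.1)

theorem field_sub (b c : ℝ) (x y : ℝ × ℝ) : field b c (x - y) = field b c x - field b c y := by
  ext <;> simp [field] <;> ring

theorem norm_field_le {b c M N : ℝ} (hb : |b| ≤ M) (hc : |c| ≤ N) (x : ℝ × ℝ) :
    ‖field b c x‖ ≤ (1 + M + M ^ 2 + N) * ‖x‖ := by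
  have h1 : |x.1| ≤ ‖x‖ := norm_fst_le x
  have h2 : |x.2| ≤ ‖x‖ := norm_snd_le x
  have hM : 0 ≤ M := (abs_nonneg b).trans hb
  have hN : 0 ≤ N := (abs_nonneg c).trans hc
  have hx : 0 ≤ ‖x‖ := norm_nonneg x
  have e1 : |b * x.1| ≤ M * ‖x‖ := by rw [abs_mul]; gcongr
  have e2 : |b * x.2| ≤ M * ‖x‖ := by rw [abs_mul]; gcongr
  have e3 : |(b ^ 2 + c) * x.1| ≤ (M ^ 2 + N) * ‖x‖ := by
    rw [abs_mul]
    have : |b ^ 2 + c| ≤ M ^ 2 + N := by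
      refine (abs_add_le _ _).trans (add_le_add ?_ hc)
      rw [abs_pow]; gcongr
    gcongr
  have f1 := abs_sub x.2 (b * x.1)
  have f2 := abs_sub (b * x.2) ((b ^ 2 + c) * x.1)
  have g1 : 0 ≤ (M ^ 2 + N) * ‖x‖ := by positivity
  rw [Prod.norm_def]
  refine max_le ?_ ?_
  · change |x.2 - b * x.1| ≤ _
    nlinarith
  · change |b * x.2 - (b ^ 2 + c) * x.1| ≤ _
    nlinarith

/-- Coordinatewise truncation to the square `[-R, R]²`. -/
def clamp (R : ℝ) (x : ℝ × ℝ) : ℝ × ℝ := (max (-R) (min R x.1), max (-R) (min R x.2))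

theorem abs_clamp_sub (R s t : ℝ) :
    |max (-R) (min R s) - max (-R) (min R t)| ≤ |s - t| :=
  (abs_max_sub_max_le_max _ _ _ _).trans <| by
    rw [sub_self, abs_zero]
    refine max_le (abs_nonneg _) ((abs_min_sub_min_le_max _ _ _ _).trans ?_)
    simp

theorem norm_clamp_sub (R : ℝ) (x y : ℝ × ℝ) : ‖clamp R x - clamp R y‖ ≤ ‖x - y‖ :=
  max_le_max (abs_clamp_sub R _ _) (abs_clamp_sub R _ _)

theorem clamp_eq {R : ℝ} {x : ℝ × ℝ} (hx : ‖x‖ ≤ R) : clamp R x = x := by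
  have h1 := abs_le.1 ((norm_fst_le x).trans hx)
  have h2 := abs_le.1 ((norm_snd_le x).trans hx)
  ext <;> simp [clamp, h1, h2]

theorem norm_clamp_le {R : ℝ} (hR : 0 ≤ R) (x : ℝ × ℝ) : ‖clamp R x‖ ≤ ‖x‖ := by
  have h := norm_clamp_sub R x 0
  rwa [clamp_eq (x := 0) (by simpa using hR), sub_zero, sub_zero] at h

theorem norm_clamp_le_radius {R : ℝ} (hR : 0 ≤ R) (x : ℝ × ℝ) : ‖clamp R x‖ ≤ R := by
  have (s : ℝ) : |max (-R) (min R s)| ≤ R := abs_le.2 ⟨le_max_left _ _,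
    max_le (by linarith) (min_le_left _ _)⟩
  exact max_le (this _) (this _)

end Field

/-! ### Initial value problems: existence and dependence on the parameter. -/

variable {B q : ℝ → ℝ}

theorem exists_abs_bound (hB : ContinuousOn B (Icc 0 1)) :
    ∃ M, ∀ t ∈ Icc (0 : ℝ) 1, |B t| ≤ M :=
  isCompact_Icc.exists_bound_of_continuousOn hB

/-- The initial value problem for the system is solvable on `[0, 1]`. -/
theorem exists_sysOn (hB : ContinuousOn B (Icc 0 1)) (hq : ContinuousOn q (Icc 0 1)) (y₀ v₀ : ℝ) :
    ∃ y v, SysOn B q 0 1 y v ∧ y 0 = y₀ ∧ v 0 = v₀ := by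
  obtain ⟨M, hM⟩ := exists_abs_bound hB
  obtain ⟨N, hN⟩ := exists_abs_bound hq
  have h0 : (0 : ℝ) ∈ Icc (0 : ℝ) 1 := by simp
  have hM0 := (abs_nonneg _).trans (hM 0 h0)
  have hN0 := (abs_nonneg _).trans (hN 0 h0)
  set K : ℝ := 1 + M + M ^ 2 + N
  have hK0 : 0 ≤ K := by positivity
  set x₀ : ℝ × ℝ := (y₀, v₀)
  -- This is the Grönwall bound at time `1`, so the truncation at radius `R` is never active along
  -- the solution.
  set R : ℝ := ‖x₀‖ * Real.exp K
  have hR0 : 0 ≤ R := by positivity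
  -- The truncated field has norm at most `K * R`, so in unit time a solution moves at most `K * R`.
  -- Picard–Lindelöf therefore covers all of `[0, 1]` at once.
  have hpl : IsPicardLindelof (fun t x => field (B t) (q t) (clamp R x))
      (⟨0, h0⟩ : Icc (0 : ℝ) 1) x₀ ⟨K * R, by positivity⟩ 0 ⟨K * R, by positivity⟩ ⟨K, hK0⟩ := by
    refine ⟨fun t ht => ?_, fun x _ => ?_, fun t ht x _ => ?_, ?_⟩
    · refine (LipschitzWith.of_dist_le_mul fun x y => ?_).lipschitzOnWith
      rw [dist_eq_norm, dist_eq_norm, ← field_sub]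
      exact (norm_field_le (hM t ht) (hN t ht) _).trans
        (mul_le_mul_of_nonneg_left (norm_clamp_sub R x y) hK0)
    · unfold field
      fun_prop
    · exact (norm_field_le (hM t ht) (hN t ht) _).trans
        (mul_le_mul_of_nonneg_left (norm_clamp_le_radius hR0 x) hK0)
    · simp
  obtain ⟨α, hα0, hα⟩ := hpl.exists_eq_forall_mem_Icc_hasDerivWithinAt₀
  have hbound : ∀ t ∈ Icc (0 : ℝ) 1, ‖α t‖ ≤ R := by
    intro t ht
    have := norm_le_gronwallBound_of_norm_deriv_right_le (K := K) (ε := 0) (δ := ‖x₀‖)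
      (f := α) (f' := fun t => field (B t) (q t) (clamp R (α t)))
      (fun t ht => (hα t ht).continuousWithinAt)
      (fun t ht => (hα t (Ico_subset_Icc_self ht)).mono_of_mem_nhdsWithin
        (Icc_mem_nhdsGE_of_mem ht)) (by rw [← hα0])
      (fun t ht => by
        have ht := Ico_subset_Icc_self ht
        rw [add_zero]
        exact (norm_field_le (hM t ht) (hN t ht) _).trans
          (mul_le_mul_of_nonneg_left (norm_clamp_le hR0 _) hK0)) t ht
    rw [gronwallBound_ε0, sub_zero] at this
    refine this.trans (mul_le_mul_of_nonneg_left (Real.exp_le_exp.2 ?_) (norm_nonneg _))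
    exact mul_le_of_le_one_right hK0 ht.2
  refine ⟨fun t => (α t).1, fun t => (α t).2, fun t ht => ?_, ?_, ?_⟩
  · have h := hα t ht
    simp only [clamp_eq (hbound t ht)] at h
    exact ⟨h.fst, h.snd⟩
  · exact congrArg Prod.fst hα0
  · exact congrArg Prod.snd hα0

/-- Solutions depend continuously on the spectral parameter, uniformly on `[0, 1]`. -/
theorem eventually_close (hB : ContinuousOn B (Icc 0 1)) {y v : ℝ → ℝ → ℝ}
    (h : ∀ lam, SysOn B (fun _ => lam) 0 1 (y lam) (v lam)) {y₀ v₀ : ℝ}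
    (hy : ∀ lam, y lam 0 = y₀) (hv : ∀ lam, v lam 0 = v₀) (mu : ℝ) {ε : ℝ} (hε : 0 < ε) :
    ∀ᶠ lam in 𝓝 mu, ∀ t ∈ Icc (0 : ℝ) 1, |y lam t - y mu t| < ε ∧ |v lam t - v mu t| < ε := by
  obtain ⟨M, hM⟩ := exists_abs_bound hB
  obtain ⟨C, hC⟩ := exists_abs_bound (h mu).continuousOn_fst
  have h0 : (0 : ℝ) ∈ Icc (0 : ℝ) 1 := by simp
  have hM0 := (abs_nonneg _).trans (hM 0 h0)
  have hC0 := (abs_nonneg _).trans (hC 0 h0)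
  set K : ℝ := 1 + M + M ^ 2 + (|mu| + 1)
  have hK0 : 0 ≤ K := by positivity
  have hlim : Tendsto (fun lam => gronwallBound 0 K (|lam - mu| * C) 1) (𝓝 mu) (𝓝 0) := by
    have : Continuous fun lam => gronwallBound 0 K (|lam - mu| * C) 1 :=
      (gronwallBound_continuous_ε 0 K 1).comp (by fun_prop)
    simpa [gronwallBound_ε0_δ0] using this.tendsto mu
  filter_upwards [hlim.eventually (gt_mem_nhds hε), Metric.ball_mem_nhds mu one_pos]
    with lam hlam hball t ht
  have hlam' : |lam| ≤ |mu| + 1 := by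
    have h1 : |lam - mu| < 1 := hball
    have h2 := abs_sub_abs_le_abs_sub lam mu
    linarith
  -- The difference of the two solutions solves the system for `lam` with zero initial data and
  -- forcing of size at most `|lam - mu| * C`.
  have key := norm_le_gronwallBound_of_norm_deriv_right_le (K := K) (ε := |lam - mu| * C) (δ := 0)
      (f := fun t => ((y lam t - y mu t, v lam t - v mu t) : ℝ × ℝ))
      (f' := fun t => field (B t) lam (y lam t - y mu t, v lam t - v mu t) -
        (0, (lam - mu) * y mu t)) (a := 0) (b := 1)
      (((h lam).continuousOn_fst.sub (h mu).continuousOn_fst).prodMk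
        ((h lam).continuousOn_snd.sub (h mu).continuousOn_snd))
      (fun t ht => by
        have ht' := Ico_subset_Icc_self ht
        refine HasDerivWithinAt.mono_of_mem_nhdsWithin ?_ (Icc_mem_nhdsGE_of_mem ht)
        refine ((((h lam t ht').1.sub (h mu t ht').1)).prodMk
          ((h lam t ht').2.sub (h mu t ht').2)).congr_deriv ?_
        ext <;> simp [field] <;> ring)
      (by simp [hy, hv])
      (fun t ht => by
        have ht := Ico_subset_Icc_self ht
        refine (norm_sub_le _ _).trans (add_le_add (norm_field_le (hM t ht) hlam' _) ?_)
        have : |(lam - mu) * y mu t| ≤ |lam - mu| * C := by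
          rw [abs_mul]; gcongr; exact hC t ht
        rw [Prod.norm_def]
        exact max_le (by simpa using by positivity) this) t ht
  have hmono := gronwallBound_mono (δ := 0) (ε := |lam - mu| * C) le_rfl (by positivity) hK0
  have := key.trans_lt ((hmono (by linarith [ht.2] : t - 0 ≤ 1)).trans_lt hlam)
  exact ⟨(norm_fst_le _).trans_lt this, (norm_snd_le _).trans_lt this⟩

/-! ### Sturm comparison and the principal Neumann eigenvalue. -/

/-- Sturm comparison. -/
theorem SysOn.comparison {q₁ q₂ y₁ v₁ y₂ v₂ : ℝ → ℝ} (h₁ : SysOn B q₁ 0 1 y₁ v₁)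
    (h₂ : SysOn B q₂ 0 1 y₂ v₂) (hq : ∀ t ∈ Icc (0 : ℝ) 1, q₂ t < q₁ t)
    (hpos : ∀ t ∈ Icc (0 : ℝ) 1, 0 < y₁ t) (hy : 0 < y₂ 0) (hw : 0 ≤ wr y₁ v₁ y₂ v₂ 0) :
    (∀ t ∈ Icc (0 : ℝ) 1, 0 < y₂ t) ∧ 0 < wr y₁ v₁ y₂ v₂ 1 := by
  have key : ∀ T ∈ Ioc (0 : ℝ) 1, (∀ t ∈ Ico 0 T, 0 < y₂ t) →
      StrictMonoOn (wr y₁ v₁ y₂ v₂) (Icc 0 T) := by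
    intro T hT hlt
    have hsub : Icc 0 T ⊆ Icc 0 1 := Icc_subset_Icc_right hT.2
    refine strictMonoOn_of_deriv_pos (convex_Icc _ _) ((h₁.continuousOn_wr h₂).mono hsub) ?_
    intro t ht
    rw [interior_Icc] at ht
    have ht1 : t ∈ Icc (0 : ℝ) 1 := hsub (Ioo_subset_Icc_self ht)
    rw [((h₁.hasDerivWithinAt_wr h₂ ht1).hasDerivAt
      (Icc_mem_nhds ht.1 (ht.2.trans_le hT.2))).deriv]
    exact mul_pos (sub_pos.2 (hq t ht1)) (mul_pos (hpos t ht1) (hlt t ⟨ht.1.le, ht.2⟩))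
  have hall : ∀ t ∈ Icc (0 : ℝ) 1, 0 < y₂ t := by
    by_contra! hcon
    have hcl : IsCompact {t | t ∈ Icc (0 : ℝ) 1 ∧ y₂ t ≤ 0} :=
      isCompact_Icc.of_isClosed_subset
        (h₂.continuousOn_fst.preimage_isClosed_of_isClosed isClosed_Icc isClosed_Iic)
        (fun t ht => ht.1)
    obtain ⟨T, ⟨hT, hyT⟩, hleast⟩ := hcl.exists_isLeast hcon
    have hT0 : 0 < T := hT.1.lt_of_ne (by rintro rfl; linarith)
    have hlt : ∀ t ∈ Ico 0 T, 0 < y₂ t := fun t ht => by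
      by_contra! hc
      exact absurd (hleast ⟨⟨ht.1, ht.2.le.trans hT.2⟩, hc⟩) (not_le.2 ht.2)
    have hwm := key T ⟨hT0, hT.2⟩ hlt
    have hsub : Icc 0 T ⊆ Icc 0 1 := Icc_subset_Icc_right hT.2
    -- Up to a first zero `T` of `y₂` the Wronskian is nonnegative, so `y₂ / y₁` cannot decrease
    -- from its positive initial value to `0`.
    have hmono : MonotoneOn (fun t => y₂ t / y₁ t) (Icc 0 T) := by
      refine monotoneOn_of_deriv_nonneg (convex_Icc _ _)
        ((h₂.continuousOn_fst.mono hsub).div (h₁.continuousOn_fst.mono hsub)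
          fun t ht => (hpos t (hsub ht)).ne') ?_ ?_
      · intro t ht
        rw [interior_Icc] at ht
        have ht1 : t ∈ Icc (0 : ℝ) 1 := hsub (Ioo_subset_Icc_self ht)
        exact ((h₁.hasDerivWithinAt_div h₂ ht1 (hpos t ht1).ne').hasDerivAt
          (Icc_mem_nhds ht.1 (ht.2.trans_le hT.2))).differentiableAt.differentiableWithinAt
      · intro t ht
        rw [interior_Icc] at ht
        have ht1 : t ∈ Icc (0 : ℝ) 1 := hsub (Ioo_subset_Icc_self ht)
        rw [((h₁.hasDerivWithinAt_div h₂ ht1 (hpos t ht1).ne').hasDerivAt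
          (Icc_mem_nhds ht.1 (ht.2.trans_le hT.2))).deriv]
        have := hwm (left_mem_Icc.2 hT0.le) (Ioo_subset_Icc_self ht) ht.1
        exact div_nonneg (hw.trans this.le) (sq_nonneg _)
    have h1 := hmono (left_mem_Icc.2 hT0.le) (right_mem_Icc.2 hT0.le) hT0.le
    have h2 : 0 < y₂ 0 / y₁ 0 := div_pos hy (hpos 0 (by simp))
    have h3 : y₂ T / y₁ T ≤ 0 := div_nonpos_of_nonpos_of_nonneg hyT (hpos T hT).le
    simp only at h1
    linarith
  refine ⟨hall, hw.trans_lt ?_⟩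
  exact key 1 (by simp) (fun t ht => hall t (Ico_subset_Icc_self ht)) (by simp) (by simp) one_pos

/-- A positive function with Neumann data that solves the system for a variable `q`. -/
theorem exists_test_function (hB : ContinuousOn B (Icc 0 1)) : ∃ u : ℝ → ℝ,
    SysOn B (fun t => -B 1 - (B 1 * t - B t) ^ 2) 0 1 u (fun t => B 1 * t * u t) ∧
      u 0 = 1 ∧ ∀ t, 0 < u t := by
  have hw : ContinuousOn (fun t => B 1 * t - B t) (Icc 0 1) := by fun_prop
  -- The logarithmic derivative `B 1 * t - B t` makes the quasi-derivative `B 1 * t * u`, which is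
  -- differentiable although `B` need not be. It equals `0` at `0` and `B 1 * u 1` at `1`: Neumann
  -- data.
  set W : ℝ → ℝ := IccExtend (zero_le_one' ℝ) ((Icc (0 : ℝ) 1).domRestrict fun t => B 1 * t - B t)
  have hW : Continuous W := hw.domRestrict.Icc_extend'
  refine ⟨fun t => Real.exp (∫ x in 0..t, W x), fun t ht => ?_, by simp, fun t => Real.exp_pos _⟩
  have hWt : W t = B 1 * t - B t := IccExtend_of_mem _ _ ht
  have hu : HasDerivWithinAt (fun t => Real.exp (∫ x in 0..t, W x))
      (Real.exp (∫ x in 0..t, W x) * W t) (Icc 0 1) t :=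
    (hW.integral_hasStrictDerivAt 0 t).hasDerivAt.exp.hasDerivWithinAt
  rw [hWt] at hu
  refine ⟨hu.congr_deriv (by ring), ?_⟩
  refine ((((hasDerivAt_id t).const_mul (B 1)).hasDerivWithinAt).mul hu).congr_deriv ?_
  simp only [id]
  ring

/-- Vanishing Cauchy data force a solution to vanish. -/
theorem SysOn.eq_zero_of_cauchy (hB : ContinuousOn B (Icc 0 1)) (hq : ContinuousOn q (Icc 0 1))
    {y v : ℝ → ℝ} (h : SysOn B q 0 1 y v) {s t : ℝ} (hs : s ∈ Icc (0 : ℝ) 1)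
    (ht : t ∈ Icc (0 : ℝ) 1) (hy : y s = 0) (hv : v s = 0) : y t = 0 := by
  obtain ⟨y₁, v₁, h₁, hy₁, hv₁⟩ := exists_sysOn hB hq 1 0
  obtain ⟨y₂, v₂, h₂, hy₂, hv₂⟩ := exists_sysOn hB hq 0 1
  -- The Wronskian of `y` with any solution is constant and vanishes at `s`. Two independent
  -- solutions then force `y t = 0`.
  have e (z w : ℝ → ℝ) (hz : SysOn B q 0 1 z w) : wr y v z w t = 0 := by
    rw [h.wr_eq hz ht hs]; simp [wr, hy, hv]
  have e₁ := e _ _ h₁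
  have e₂ := e _ _ h₂
  have e₃ : wr y₁ v₁ y₂ v₂ t = 1 := by
    rw [h₁.wr_eq_left h₂ ht]; simp [wr, hy₁, hv₁, hy₂, hv₂]
  simp only [wr] at e₁ e₂ e₃
  linear_combination (-y t) * e₃ + y₁ t * e₂ - y₂ t * e₁

/-- There is a parameter with a positive Neumann solution. -/
theorem exists_principal (hB : ContinuousOn B (Icc 0 1)) : ∃ mu, ∃ y v : ℝ → ℝ,
    SysOn B (fun _ => mu) 0 1 y v ∧ y 0 = 1 ∧ v 0 = 0 ∧ (∀ t ∈ Icc (0 : ℝ) 1, 0 < y t) ∧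
      v 1 - B 1 * y 1 = 0 := by
  have h01 : (0 : ℝ) ∈ Icc (0 : ℝ) 1 := by simp
  have h11 : (1 : ℝ) ∈ Icc (0 : ℝ) 1 := by simp
  choose y v hs hy hv using fun lam : ℝ => exists_sysOn hB (continuousOn_const (c := lam)) 1 0
  obtain ⟨u, hu, hu0, hupos⟩ := exists_test_function hB
  obtain ⟨M, hM⟩ := exists_abs_bound (B := fun t => B 1 * t - B t) (by fun_prop)
  -- The last condition says `y' 1 > 0`.
  set S : Set ℝ := {lam | (∀ t ∈ Icc (0 : ℝ) 1, 0 < y lam t) ∧ 0 < v lam 1 - B 1 * y lam 1}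
  -- The test function solves the system for a `q` lying between `-B 1 - M ^ 2` and `-B 1`. A
  -- parameter below this range belongs to `S`; for one above it the comparison with roles exchanged
  -- rules out `y' 1 > 0`.
  have hne : (-B 1 - M ^ 2 - 1) ∈ S := by
    set lam := -B 1 - M ^ 2 - 1
    obtain ⟨h1, h2⟩ := hu.comparison (hs lam) (fun t ht => by
      have : (B 1 * t - B t) ^ 2 ≤ M ^ 2 := sq_le_sq' (abs_le.1 (hM t ht)).1 (abs_le.1 (hM t ht)).2
      linarith) (fun t _ => hupos t) (by simp [hy]) (by simp [wr, hv])
    refine ⟨h1, ?_⟩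
    have h3 : 0 < u 1 * (v lam 1 - B 1 * y lam 1) := by
      convert h2 using 1; simp only [wr]; ring
    exact pos_of_mul_pos_right h3 (hupos 1).le
  have hbdd : ∀ lam ∈ S, lam ≤ -B 1 := by
    rintro lam ⟨hl1, hl2⟩
    by_contra! hlt
    obtain ⟨-, h2⟩ := (hs lam).comparison hu (fun t ht => by
      linarith [sq_nonneg (B 1 * t - B t)]) hl1 (by simp [hu0]) (by simp [wr, hv])
    have h3 := mul_pos (hupos 1) hl2
    simp only [wr] at h2
    linarith
  have hba : BddAbove S := ⟨_, hbdd⟩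
  set mu := sSup S
  have hlub : IsLUB S mu := isLUB_csSup ⟨_, hne⟩ hba
  have hcl : ∃ᶠ lam in 𝓝 mu, lam ∈ S := mem_closure_iff_frequently.1 (hlub.mem_closure ⟨_, hne⟩)
  have hlim_y (t : ℝ) (ht : t ∈ Icc (0 : ℝ) 1) : Tendsto (fun lam => y lam t) (𝓝 mu) (𝓝 (y mu t)) :=
    Metric.tendsto_nhds.2 fun ε hε => (eventually_close hB hs hy hv mu hε).mono fun _ h => (h t ht).1
  have hlim_v (t : ℝ) (ht : t ∈ Icc (0 : ℝ) 1) : Tendsto (fun lam => v lam t) (𝓝 mu) (𝓝 (v mu t)) :=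
    Metric.tendsto_nhds.2 fun ε hε => (eventually_close hB hs hy hv mu hε).mono fun _ h => (h t ht).2
  have hlim_d := (hlim_v 1 h11).sub ((hlim_y 1 h11).const_mul (B 1))
  have hnonneg : ∀ t ∈ Icc (0 : ℝ) 1, 0 ≤ y mu t := fun t ht =>
    ge_of_tendsto_of_frequently (hlim_y t ht) (hcl.mono fun _ h => (h.1 t ht).le)
  have hd : 0 ≤ v mu 1 - B 1 * y mu 1 :=
    ge_of_tendsto_of_frequently hlim_d (hcl.mono fun _ h => h.2.le)
  have hpos : ∀ t ∈ Icc (0 : ℝ) 1, 0 < y mu t := by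
    intro t ht
    refine (hnonneg t ht).lt_of_ne' fun h0 => ?_
    -- A zero of a nonnegative solution is a minimum, so the derivative vanishes there. At the
    -- endpoint `1` a minimum only gives `y' 1 ≤ 0`, and `hd` supplies the other sign.
    have hv0 : v mu t = 0 := by
      have hder := (hs mu t ht).1
      have hmin : IsMinOn (y mu) (Icc 0 1) t := fun x hx => by
        simpa [h0] using hnonneg x hx
      rcases ht.1.eq_or_lt with rfl | ht0
      · exact hv mu
      rcases ht.2.eq_or_lt with rfl | ht1
      · refine le_antisymm ?_ (by simpa [h0] using hd)
        have hmem : (-1 : ℝ) ∈ posTangentConeAt (Icc (0 : ℝ) 1) 1 := by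
          have := mem_posTangentConeAt_of_segment_subset (s := Icc (0 : ℝ) 1) (x := 1) (y := -1)
            (by
              rw [segment_symm, segment_eq_Icc (by norm_num)]
              intro x hx
              constructor <;> norm_num at hx ⊢ <;> linarith [hx.1, hx.2])
          simpa using this
        have := hmin.localize.hasFDerivWithinAt_nonneg hder.hasFDerivWithinAt hmem
        simpa [h0] using this
      · have := (hmin.isLocalMin (Icc_mem_nhds ht0 ht1)).hasDerivAt_eq_zero
          (hder.hasDerivAt (Icc_mem_nhds ht0 ht1))
        simpa [h0] using this
    have := (hs mu).eq_zero_of_cauchy hB continuousOn_const ht h01 h0 hv0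
    rw [hy] at this
    exact one_ne_zero this
  refine ⟨mu, y mu, v mu, hs mu, hy mu, hv mu, hpos, (hd.eq_or_lt.resolve_right fun hlt => ?_).symm⟩
  obtain ⟨x, hx, hmin⟩ := isCompact_Icc.exists_isMinOn ⟨0, h01⟩ (hs mu).continuousOn_fst
  -- If `y' 1 > 0` at `mu`, both strict conditions persist nearby, so `S` would contain parameters
  -- above its supremum.
  have hev : ∀ᶠ lam in 𝓝 mu, lam ∈ S := by
    filter_upwards [eventually_close hB hs hy hv mu (hpos x hx), hlim_d.eventually (lt_mem_nhds hlt)]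
      with lam h1 h2
    refine ⟨fun t ht => ?_, h2⟩
    have h3 := (abs_lt.1 (h1 t ht).1).1
    have h4 : y mu x ≤ y mu t := hmin ht
    linarith
  obtain ⟨l, hl, hl'⟩ := (hev.filter_mono nhdsWithin_le_nhds).and
    (self_mem_nhdsWithin : Ioi mu ∈ 𝓝[>] mu) |>.exists
  exact absurd (hlub.1 hl) (not_le.2 hl')

/-! ### Equivalence of the `W^{2,1}` equation and the system. -/

theorem absolutelyContinuousOnInterval_congr {f g : ℝ → ℝ} {p r : ℝ}
    (hf : AbsolutelyContinuousOnInterval f p r) (h : EqOn f g (uIcc p r)) :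
    AbsolutelyContinuousOnInterval g p r := by
  rw [absolutelyContinuousOnInterval_iff] at hf ⊢
  intro ε hε
  obtain ⟨δ, hδ, H⟩ := hf ε hε
  refine ⟨δ, hδ, fun E hE hlt => ?_⟩
  convert H E hE hlt using 1
  exact Finset.sum_congr rfl fun i hi => by rw [h (hE.1 i hi).1, h (hE.1 i hi).2]

/-- An absolutely continuous function whose derivative is a.e. equal to a continuous function
is continuously differentiable. -/
theorem hasDerivWithinAt_of_ae_hasDerivAt {f g : ℝ → ℝ} {p r : ℝ} (hpr : p ≤ r)
    (hf : AbsolutelyContinuousOnInterval f p r) (hg : ContinuousOn g (Icc p r))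
    (h : ∀ᵐ t, t ∈ Icc p r → HasDerivAt f (g t) t) {t : ℝ} (ht : t ∈ Icc p r) :
    HasDerivWithinAt f (g t) (Icc p r) t := by
  set W : ℝ → ℝ := IccExtend hpr ((Icc p r).domRestrict g)
  have hW : Continuous W := hg.domRestrict.Icc_extend'
  have hWg : ∀ t ∈ Icc p r, W t = g t := fun t ht => IccExtend_of_mem _ _ ht
  have hI (t : ℝ) : HasDerivAt (fun x => ∫ s in p..x, W s) (W t) t :=
    (hW.integral_hasStrictDerivAt p t).hasDerivAt
  have hac := hf.fun_sub
    ((hW.intervalIntegrable p r).absolutelyContinuousOnInterval_intervalIntegral (c := p) (by simp))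
  obtain ⟨C, hC⟩ := hac.const_of_ae_hasDerivAt_zero (by
    filter_upwards [h] with x hx hxm
    rw [uIcc_of_le hpr] at hxm
    refine ((hx hxm).sub (hI x)).congr_deriv ?_
    rw [hWg x hxm, sub_self])
  rw [uIcc_of_le hpr] at hC
  rw [← hWg t ht]
  exact ((hI t).const_add C).hasDerivWithinAt.congr_of_mem
    (fun x hx => by simp only [← hC x hx]; ring) ht

section Translation

variable {a : ℝ → ℝ} {lam p r : ℝ} {u v : ℝ → ℝ}

/-- The primitive of `a` vanishing at `0`. -/
noncomputable def primitive (a : ℝ → ℝ) (t : ℝ) : ℝ := ∫ x in (0 : ℝ)..t, a x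

theorem primitive_zero : primitive a 0 = 0 := intervalIntegral.integral_same

theorem primitive_absolutelyContinuous (ha : IntegrableOn a (Icc (0 : ℝ) 1) volume) :
    AbsolutelyContinuousOnInterval (primitive a) 0 1 :=
  ((intervalIntegrable_iff_integrableOn_Icc_of_le zero_le_one).2
    ha).absolutelyContinuousOnInterval_intervalIntegral (by simp)

theorem continuousOn_primitive (ha : IntegrableOn a (Icc (0 : ℝ) 1) volume) :
    ContinuousOn (primitive a) (Icc 0 1) := by
  simpa using (primitive_absolutelyContinuous ha).continuousOn

theorem ae_hasDerivAt_primitive (ha : IntegrableOn a (Icc (0 : ℝ) 1) volume) :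
    ∀ᵐ t, t ∈ Icc (0 : ℝ) 1 → HasDerivAt (primitive a) (a t) t := by
  filter_upwards [((intervalIntegrable_iff_integrableOn_Icc_of_le zero_le_one).2
    ha).ae_hasDerivAt_integral] with t ht hmem
  exact ht (by simpa using hmem) 0 (by simp)

theorem SysOn.congr {B q : ℝ → ℝ} {u' v' : ℝ → ℝ} (h : SysOn B q p r u v)
    (hu : EqOn u' u (Icc p r)) (hv : EqOn v' v (Icc p r)) : SysOn B q p r u' v' := by
  intro t ht
  rw [hu ht, hv ht]
  exact ⟨(h t ht).1.congr_of_mem hu ht, (h t ht).2.congr_of_mem hv ht⟩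

theorem SysOn.derivWithin_fst {B q : ℝ → ℝ} (h : SysOn B q p r u v) (hpr : p < r) {t : ℝ}
    (ht : t ∈ Icc p r) : derivWithin u (Icc p r) t = v t - B t * u t :=
  (h t ht).1.derivWithin (uniqueDiffOn_Icc hpr t ht)

theorem SysOn.continuousOn_deriv {B q : ℝ → ℝ} (h : SysOn B q p r u v)
    (hB : ContinuousOn B (Icc p r)) : ContinuousOn (fun t => v t - B t * u t) (Icc p r) :=
  h.continuousOn_snd.sub (hB.mul h.continuousOn_fst)

theorem SysOn.contDiffOn_fst {B q : ℝ → ℝ} (h : SysOn B q p r u v) (hpr : p < r)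
    (hB : ContinuousOn B (Icc p r)) : ContDiffOn ℝ 1 u (Icc p r) :=
  (contDiffOn_one_iff_derivWithin (uniqueDiffOn_Icc hpr)).2
    ⟨fun t ht => (h t ht).1.differentiableWithinAt,
      (h.continuousOn_deriv hB).congr fun _ ht => h.derivWithin_fst hpr ht⟩

theorem SysOn.solvesHomogeneous (ha : IntegrableOn a (Icc (0 : ℝ) 1) volume) (hpr : p < r)
    (hsub : Icc p r ⊆ Icc 0 1) (h : SysOn (primitive a) (fun _ => lam) p r u v) :
    SolvesHomogeneous a lam p r u := by
  have hB := continuousOn_primitive ha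
  have hudiff := uniqueDiffOn_Icc hpr
  have hu1 := h.contDiffOn_fst hpr (hB.mono hsub)
  have hv1 : ContDiffOn ℝ 1 v (Icc p r) := by
    refine (contDiffOn_one_iff_derivWithin hudiff).2
      ⟨fun t ht => (h t ht).2.differentiableWithinAt, ?_⟩
    refine ContinuousOn.congr (f := fun t => primitive a t * v t -
      (primitive a t ^ 2 + lam) * u t) ?_ fun t ht => (h t ht).2.derivWithin (hudiff t ht)
    have := hB.mono hsub
    have := h.continuousOn_fst
    have := h.continuousOn_snd
    fun_prop
  have huIcc : uIcc p r = Icc p r := uIcc_of_le hpr.le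
  refine ⟨⟨fun t ht => (h t ht).1.differentiableWithinAt, ?_⟩, ?_⟩
  · refine absolutelyContinuousOnInterval_congr (f := fun t => v t - primitive a t * u t) ?_
      fun t ht => (h.derivWithin_fst hpr (huIcc ▸ ht)).symm
    refine (ContDiffOn.absolutelyContinuousOnInterval (huIcc.symm ▸ hv1)).fun_sub
      (((primitive_absolutelyContinuous ha).mono ?_).fun_mul
        (ContDiffOn.absolutelyContinuousOnInterval (huIcc.symm ▸ hu1)))
    rwa [huIcc, uIcc_of_le zero_le_one]
  · rw [ae_restrict_iff' measurableSet_Icc]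
    have hne (x : ℝ) : ∀ᵐ t : ℝ, t ≠ x := by simp [ae_iff, measure_singleton]
    filter_upwards [ae_hasDerivAt_primitive ha, hne p, hne r] with t hBt htp htr ht
    have hn : Icc p r ∈ 𝓝 t := Icc_mem_nhds (ht.1.lt_of_ne' htp) (ht.2.lt_of_ne htr)
    have h1 := (h t ht).1.hasDerivAt hn
    have h2 := (h t ht).2.hasDerivAt hn
    have h3 := h2.sub ((hBt (hsub ht)).mul h1)
    have h4 : derivWithin u (Icc p r) =ᶠ[𝓝 t] v - primitive a * u := by
      filter_upwards [hn] with x hx using h.derivWithin_fst hpr hx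
    rw [h4.deriv_eq, h3.deriv]
    ring

/-- The quasi-derivative is absolutely continuous and the `a` terms cancel in its a.e. derivative.
What remains is continuous, so the equation for `v` holds at every point. -/
theorem SolvesHomogeneous.sysOn (ha : IntegrableOn a (Icc (0 : ℝ) 1) volume) (hpr : p < r)
    (hsub : Icc p r ⊆ Icc 0 1) (h : SolvesHomogeneous a lam p r u) :
    SysOn (primitive a) (fun _ => lam) p r u
      (fun t => derivWithin u (Icc p r) t + primitive a t * u t) := by
  obtain ⟨⟨hdiff, hac⟩, hode⟩ := h
  have hB := (continuousOn_primitive ha).mono hsub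
  have huIcc : uIcc p r = Icc p r := uIcc_of_le hpr.le
  have hu' : ContinuousOn (derivWithin u (Icc p r)) (Icc p r) := huIcc ▸ hac.continuousOn
  have huc : ContinuousOn u (Icc p r) := hdiff.continuousOn
  have hu1 : ContDiffOn ℝ 1 u (uIcc p r) :=
    huIcc.symm ▸ (contDiffOn_one_iff_derivWithin (uniqueDiffOn_Icc hpr)).2 ⟨hdiff, hu'⟩
  have hBac : AbsolutelyContinuousOnInterval (primitive a) p r :=
    (primitive_absolutelyContinuous ha).mono (by rwa [huIcc, uIcc_of_le zero_le_one])
  intro t ht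
  refine ⟨(hdiff t ht).hasDerivWithinAt.congr_deriv (by ring), ?_⟩
  refine hasDerivWithinAt_of_ae_hasDerivAt hpr.le
    (hac.fun_add (hBac.fun_mul hu1.absolutelyContinuousOnInterval)) (g := fun t => primitive a t *
      (derivWithin u (Icc p r) t + primitive a t * u t) - (primitive a t ^ 2 + lam) * u t)
    (by fun_prop) ?_ ht
  rw [ae_restrict_iff' measurableSet_Icc] at hode
  have hne (x : ℝ) : ∀ᵐ t : ℝ, t ≠ x := by simp [ae_iff, measure_singleton]
  filter_upwards [ae_hasDerivAt_primitive ha, hne p, hne r, hode, hac.ae_differentiableAt]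
    with x hBx hxp hxr hx hxd hxm
  have hn : Icc p r ∈ 𝓝 x := Icc_mem_nhds (hxm.1.lt_of_ne' hxp) (hxm.2.lt_of_ne hxr)
  have h1 := (hdiff x hxm).hasDerivWithinAt.hasDerivAt hn
  have h2 := (hxd (huIcc.symm ▸ hxm)).hasDerivAt
  refine (h2.add ((hBx (hsub hxm)).mul h1)).congr_deriv ?_
  linear_combination hx hxm

end Translation

/-! ### Construction of Green's functions. -/

section Kernel

/-- The kernel built from a solution `φ` for the left and a solution `ψ` for the right boundary
condition, with Wronskian `W`. -/
noncomputable def kernel (φ ψ : ℝ → ℝ) (W t s : ℝ) : ℝ := φ (min t s) * ψ (max t s) / W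

variable {a φ vφ ψ vψ : ℝ → ℝ} {B : ℝ → ℝ} {lam W t s : ℝ} {Bc : (ℝ → ℝ) → Prop}

theorem kernel_of_le (h : t ≤ s) : kernel φ ψ W t s = φ t * ψ s / W := by
  rw [kernel, min_eq_left h, max_eq_right h]

theorem kernel_of_ge (h : s ≤ t) : kernel φ ψ W t s = φ s * ψ t / W := by
  rw [kernel, min_eq_right h, max_eq_left h]

theorem partialT_kernel_of_lt {q : ℝ → ℝ} (hφ : SysOn B q 0 1 φ vφ) (ht : t ∈ Icc (0 : ℝ) 1)
    (h : t < s) : partialT (kernel φ ψ W) t s = (vφ t - B t * φ t) * (ψ s / W) := by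
  have h1 := (hφ t ht).1.mul_const (ψ s / W)
  refine (h1.congr_of_eventuallyEq_of_mem ?_ ht).derivWithin
    (uniqueDiffOn_Icc one_pos t ht)
  filter_upwards [mem_nhdsWithin_of_mem_nhds (Iio_mem_nhds h)] with x hx
  rw [kernel_of_le (le_of_lt hx), mul_div_assoc]

theorem partialT_kernel_of_gt {q : ℝ → ℝ} (hψ : SysOn B q 0 1 ψ vψ) (ht : t ∈ Icc (0 : ℝ) 1)
    (h : s < t) : partialT (kernel φ ψ W) t s = (vψ t - B t * ψ t) * (φ s / W) := by
  have h1 := (hψ t ht).1.mul_const (φ s / W)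
  refine (h1.congr_of_eventuallyEq_of_mem ?_ ht).derivWithin
    (uniqueDiffOn_Icc one_pos t ht)
  filter_upwards [mem_nhdsWithin_of_mem_nhds (Ioi_mem_nhds h)] with x hx
  rw [kernel_of_ge (le_of_lt hx)]
  ring

theorem continuousOn_kernel (hφ : ContinuousOn φ (Icc 0 1)) (hψ : ContinuousOn ψ (Icc 0 1)) :
    ContinuousOn (fun p : ℝ × ℝ => kernel φ ψ W p.1 p.2) (Icc 0 1 ×ˢ Icc 0 1) := by
  refine ((hφ.comp (f := fun p : ℝ × ℝ => min p.1 p.2) (by fun_prop) ?_).mul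
    (hψ.comp (f := fun p : ℝ × ℝ => max p.1 p.2) (by fun_prop) ?_)).div_const W
  · rintro p ⟨h1, h2⟩
    exact ⟨le_min h1.1 h2.1, (min_le_left _ _).trans h1.2⟩
  · rintro p ⟨h1, h2⟩
    exact ⟨h1.1.trans (le_max_left _ _), max_le h1.2 h2.2⟩

theorem contDiffOn_kernel (hφ : ContDiffOn ℝ 1 φ (Icc 0 1)) (hψ : ContDiffOn ℝ 1 ψ (Icc 0 1)) :
    ContDiffOn ℝ 1 (fun p : ℝ × ℝ => kernel φ ψ W p.1 p.2)
      {p : ℝ × ℝ | p ∈ Icc (0 : ℝ) 1 ×ˢ Icc (0 : ℝ) 1 ∧ p.1 ≠ p.2} := by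
  have hm1 : MapsTo Prod.fst {p : ℝ × ℝ | p ∈ Icc (0 : ℝ) 1 ×ˢ Icc (0 : ℝ) 1 ∧ p.1 ≠ p.2}
    (Icc 0 1) := fun p hp => hp.1.1
  have hm2 : MapsTo Prod.snd {p : ℝ × ℝ | p ∈ Icc (0 : ℝ) 1 ×ˢ Icc (0 : ℝ) 1 ∧ p.1 ≠ p.2}
    (Icc 0 1) := fun p hp => hp.1.2
  have hle := ((hφ.comp contDiff_fst.contDiffOn hm1).mul
    (hψ.comp contDiff_snd.contDiffOn hm2)).div_const W
  have hge := ((hφ.comp contDiff_snd.contDiffOn hm2).mul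
    (hψ.comp contDiff_fst.contDiffOn hm1)).div_const W
  intro p hp
  rcases lt_or_gt_of_ne hp.2 with h | h
  · refine (hle p hp).congr_of_eventuallyEq_of_mem ?_ hp
    filter_upwards [mem_nhdsWithin_of_mem_nhds
      ((isOpen_lt continuous_fst continuous_snd).mem_nhds h)] with x hx
    exact kernel_of_le (le_of_lt hx)
  · refine (hge p hp).congr_of_eventuallyEq_of_mem ?_ hp
    filter_upwards [mem_nhdsWithin_of_mem_nhds
      ((isOpen_lt continuous_snd continuous_fst).mem_nhds h)] with x hx
    exact kernel_of_ge (le_of_lt hx)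

/-- On each side of the diagonal a section is a multiple of one solution, and the jump of its
derivative is the Wronskian divided by `W`. -/
theorem isGreenFunction_kernel (ha : IntegrableOn a (Icc (0 : ℝ) 1) volume)
    (hφ : SysOn (primitive a) (fun _ => lam) 0 1 φ vφ)
    (hψ : SysOn (primitive a) (fun _ => lam) 0 1 ψ vψ)
    (hW : ∀ t ∈ Icc (0 : ℝ) 1, wr φ vφ ψ vψ t = W) (hW0 : W ≠ 0)
    (hBc : ∀ s ∈ Ioo (0 : ℝ) 1, Bc fun t => kernel φ ψ W t s) :
    IsGreenFunction a lam Bc (kernel φ ψ W) where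
  continuousOn := continuousOn_kernel hφ.continuousOn_fst hψ.continuousOn_fst
  contDiffOn := contDiffOn_kernel (hφ.contDiffOn_fst one_pos (continuousOn_primitive ha))
    (hψ.contDiffOn_fst one_pos (continuousOn_primitive ha))
  solves_left s hs q hq := by
    have hsub : Icc 0 q ⊆ Icc 0 1 := Icc_subset_Icc_right (hq.2.trans hs.2).le
    refine (((hφ.mono hsub).linComb (hφ.mono hsub) (ψ s / W) 0).congr (fun t ht => ?_)
      fun t _ => rfl).solvesHomogeneous ha hq.1 hsub
    simp only [kernel_of_le (ht.2.trans hq.2.le)]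
    ring
  solves_right s hs p hp := by
    have hsub : Icc p 1 ⊆ Icc 0 1 := Icc_subset_Icc_left (hs.1.trans hp.1).le
    refine (((hψ.mono hsub).linComb (hψ.mono hsub) (φ s / W) 0).congr (fun t ht => ?_)
      fun t _ => rfl).solvesHomogeneous ha hp.2 hsub
    simp only [kernel_of_ge (hp.1.le.trans ht.1)]
    ring
  boundary := hBc
  jump t ht := by
    have hn : Icc (0 : ℝ) 1 ∈ 𝓝 t := Icc_mem_nhds ht.1 ht.2
    have ht' := Ioo_subset_Icc_self ht
    have hB := continuousOn_primitive ha
    have cφ := hφ.continuousOn_fst.continuousAt hn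
    have cψ := hψ.continuousOn_fst.continuousAt hn
    have dφ := (hφ.continuousOn_deriv hB).continuousAt hn
    have dψ := (hψ.continuousOn_deriv hB).continuousAt hn
    refine ⟨(vφ t - primitive a t * φ t) * (ψ t / W), (vψ t - primitive a t * ψ t) * (φ t / W),
      ?_, ?_, ?_, ?_, ?_⟩
    · refine Tendsto.congr' ?_ ((dφ.tendsto.mul_const (ψ t / W)).mono_left nhdsWithin_le_nhds)
      filter_upwards [self_mem_nhdsWithin, mem_nhdsWithin_of_mem_nhds hn] with x hx hx'
      exact (partialT_kernel_of_lt hφ hx' hx).symm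
    · refine Tendsto.congr' ?_ (((cψ.tendsto.div_const W).const_mul
        (vφ t - primitive a t * φ t)).mono_left nhdsWithin_le_nhds)
      filter_upwards [self_mem_nhdsWithin] with x hx
      exact (partialT_kernel_of_lt hφ ht' hx).symm
    · refine Tendsto.congr' ?_ ((dψ.tendsto.mul_const (φ t / W)).mono_left nhdsWithin_le_nhds)
      filter_upwards [self_mem_nhdsWithin, mem_nhdsWithin_of_mem_nhds hn] with x hx hx'
      exact (partialT_kernel_of_gt hψ hx' hx).symm
    · refine Tendsto.congr' ?_ (((cφ.tendsto.div_const W).const_mul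
        (vψ t - primitive a t * ψ t)).mono_left nhdsWithin_le_nhds)
      filter_upwards [self_mem_nhdsWithin] with x hx
      exact (partialT_kernel_of_gt hψ ht' hx).symm
    · have := hW t ht'
      simp only [wr] at this
      field_simp
      linarith

end Kernel

/-! ### Uniqueness of Green's functions. -/

section Uniqueness

variable {a φ vφ ψ vψ : ℝ → ℝ} {B q : ℝ → ℝ} {lam W t s : ℝ} {Bc : (ℝ → ℝ) → Prop}

/-- A function that solves the system on both sides of `s`, is continuously differentiable across
`s` and satisfies nondegenerate boundary conditions vanishes. -/
theorem eq_zero_of_two_sided (hφ : SysOn B q 0 1 φ vφ) (hψ : SysOn B q 0 1 ψ vψ)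
    (hW : ∀ t ∈ Icc (0 : ℝ) 1, wr φ vφ ψ vψ t = W) (hW0 : W ≠ 0) {d vd : ℝ → ℝ} {n : ℝ}
    (hs : s ∈ Ioo (0 : ℝ) 1) (hl : ∀ c ∈ Ioo 0 s, SysOn B q 0 c d vd)
    (hr : ∀ c ∈ Ioo s 1, SysOn B q c 1 d vd)
    (hdl : Tendsto d (𝓝[<] s) (𝓝 (d s))) (hdr : Tendsto d (𝓝[>] s) (𝓝 (d s)))
    (hvl : Tendsto vd (𝓝[<] s) (𝓝 n)) (hvr : Tendsto vd (𝓝[>] s) (𝓝 n))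
    (h0 : wr φ vφ d vd 0 = 0) (h1 : wr ψ vψ d vd 1 = 0) (ht : t ∈ Icc (0 : ℝ) 1) : d t = 0 := by
  have hn : Icc (0 : ℝ) 1 ∈ 𝓝 s := Icc_mem_nhds hs.1 hs.2
  have hs' := Ioo_subset_Icc_self hs
  -- The Wronskian of `d` with a global solution is constant on each side of `s`. Both constants
  -- equal the common limit at `s`.
  have hleft {z vz : ℝ → ℝ} (hz : SysOn B q 0 1 z vz) :
      ∀ x ∈ Ico 0 s, wr z vz d vd x = z s * n - vz s * d s := by
    have hconst : ∀ x ∈ Ico 0 s, wr z vz d vd x = wr z vz d vd 0 := fun x hx => by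
      obtain ⟨c, hc1, hc2⟩ := exists_between hx.2
      have hc0 : 0 < c := hx.1.trans_lt hc1
      exact (hz.mono (Icc_subset_Icc_right (hc2.trans hs.2).le)).wr_eq_left
        (hl c ⟨hc0, hc2⟩) ⟨hx.1, hc1.le⟩
    have hlim : Tendsto (wr z vz d vd) (𝓝[<] s) (𝓝 (z s * n - vz s * d s)) :=
      (((hz.continuousOn_fst.continuousAt hn).tendsto.mono_left nhdsWithin_le_nhds).mul hvl).sub
        (((hz.continuousOn_snd.continuousAt hn).tendsto.mono_left nhdsWithin_le_nhds).mul hdl)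
    have hlim' : Tendsto (wr z vz d vd) (𝓝[<] s) (𝓝 (wr z vz d vd 0)) := by
      refine tendsto_const_nhds.congr' ?_
      filter_upwards [Ico_mem_nhdsLT hs.1] with x hx using (hconst x hx).symm
    intro x hx
    rw [hconst x hx, tendsto_nhds_unique hlim hlim']
  have hright {z vz : ℝ → ℝ} (hz : SysOn B q 0 1 z vz) :
      ∀ x ∈ Ioc s 1, wr z vz d vd x = z s * n - vz s * d s := by
    have hconst : ∀ x ∈ Ioc s 1, wr z vz d vd x = wr z vz d vd 1 := fun x hx => by
      obtain ⟨c, hc1, hc2⟩ := exists_between hx.1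
      have hc0 : c < 1 := hc2.trans_le hx.2
      exact (hz.mono (Icc_subset_Icc_left (hs.1.trans hc1).le)).wr_eq
        (hr c ⟨hc1, hc0⟩) ⟨hc2.le, hx.2⟩ ⟨hc0.le, le_rfl⟩
    have hlim : Tendsto (wr z vz d vd) (𝓝[>] s) (𝓝 (z s * n - vz s * d s)) :=
      (((hz.continuousOn_fst.continuousAt hn).tendsto.mono_left nhdsWithin_le_nhds).mul hvr).sub
        (((hz.continuousOn_snd.continuousAt hn).tendsto.mono_left nhdsWithin_le_nhds).mul hdr)
    have hlim' : Tendsto (wr z vz d vd) (𝓝[>] s) (𝓝 (wr z vz d vd 1)) := by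
      refine tendsto_const_nhds.congr' ?_
      filter_upwards [Ioc_mem_nhdsGT hs.2] with x hx using (hconst x hx).symm
    intro x hx
    rw [hconst x hx, tendsto_nhds_unique hlim hlim']
  have e0 := (hleft hφ 0 ⟨le_rfl, hs.1⟩).symm.trans h0
  have e1 := (hright hψ 1 ⟨hs.2, le_rfl⟩).symm.trans h1
  -- At any point, vanishing Wronskians with both `φ` and `ψ` form an invertible linear system, of
  -- determinant `W` up to sign.
  have cramer : ∀ x ∈ Icc (0 : ℝ) 1, ∀ y w : ℝ, φ x * w - vφ x * y = 0 →
      ψ x * w - vψ x * y = 0 → y = 0 ∧ w = 0 := by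
    intro x hx y w k1 k2
    have k := hW x hx
    simp only [wr] at k
    constructor
    · refine (mul_eq_zero.1 (?_ : W * y = 0)).resolve_left hW0
      rw [← k]; linear_combination ψ x * k1 - φ x * k2
    · refine (mul_eq_zero.1 (?_ : W * w = 0)).resolve_left hW0
      rw [← k]; linear_combination vψ x * k1 - vφ x * k2
  obtain ⟨hds, rfl⟩ := cramer s hs' _ _ e0 e1
  rcases lt_trichotomy t s with h | rfl | h
  · have f1 := hleft hφ t ⟨ht.1, h⟩
    have f2 := hleft hψ t ⟨ht.1, h⟩
    rw [hds, mul_zero, mul_zero, sub_zero] at f1 f2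
    exact (cramer t ht _ _ f1 f2).1
  · exact hds
  · have f1 := hright hφ t ⟨h, ht.2⟩
    have f2 := hright hψ t ⟨h, ht.2⟩
    rw [hds, mul_zero, mul_zero, sub_zero] at f1 f2
    exact (cramer t ht _ _ f1 f2).1

theorem IsGreenFunction.sysOn_left (ha : IntegrableOn a (Icc (0 : ℝ) 1) volume) {G : ℝ → ℝ → ℝ}
    (hG : IsGreenFunction a lam Bc G) (hs : s ∈ Ioo (0 : ℝ) 1) {c : ℝ} (hc : c ∈ Ioo 0 s) :
    SysOn (primitive a) (fun _ => lam) 0 c (fun t => G t s)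
      (fun t => partialT G t s + primitive a t * G t s) := by
  -- Working on the larger interval `[0, e]` keeps `c` away from the endpoint, so derivatives within
  -- `[0, e]` and `[0, 1]` agree on `[0, c]`.
  obtain ⟨e, hce, hes⟩ := exists_between hc.2
  refine (((hG.solves_left s hs e ⟨hc.1.trans hce, hes⟩).sysOn ha (hc.1.trans hce)
    (Icc_subset_Icc_right (hes.trans hs.2).le)).mono (Icc_subset_Icc_right hce.le)).congr
    (fun t _ => rfl) fun t ht => ?_
  simp only [partialT]
  congr 1
  refine derivWithin_congr_set ?_
  filter_upwards [Iio_mem_nhds (ht.2.trans_lt hce)] with x hx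
  exact propext ⟨fun h => ⟨h.1, le_of_lt hx⟩, fun h => ⟨h.1, h.2.trans (hes.trans hs.2).le⟩⟩

theorem IsGreenFunction.sysOn_right (ha : IntegrableOn a (Icc (0 : ℝ) 1) volume) {G : ℝ → ℝ → ℝ}
    (hG : IsGreenFunction a lam Bc G) (hs : s ∈ Ioo (0 : ℝ) 1) {c : ℝ} (hc : c ∈ Ioo s 1) :
    SysOn (primitive a) (fun _ => lam) c 1 (fun t => G t s)
      (fun t => partialT G t s + primitive a t * G t s) := by
  obtain ⟨e, hse, hec⟩ := exists_between hc.1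
  refine (((hG.solves_right s hs e ⟨hse, hec.trans hc.2⟩).sysOn ha (hec.trans hc.2)
    (Icc_subset_Icc_left (hs.1.trans hse).le)).mono (Icc_subset_Icc_left hec.le)).congr
    (fun t _ => rfl) fun t ht => ?_
  simp only [partialT]
  congr 1
  refine derivWithin_congr_set ?_
  filter_upwards [Ioi_mem_nhds (hec.trans_le ht.1)] with x hx
  exact propext ⟨fun h => ⟨le_of_lt hx, h.2⟩, fun h => ⟨(hs.1.trans hse).le.trans h.1, h.2⟩⟩

/-- Uniqueness of the Green's function, when `φ` and `ψ` are independent solutions and the boundary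
conditions are those satisfied by `φ` at `0` and by `ψ` at `1`. -/
theorem IsGreenFunction.unique (ha : IntegrableOn a (Icc (0 : ℝ) 1) volume)
    (hφ : SysOn (primitive a) (fun _ => lam) 0 1 φ vφ)
    (hψ : SysOn (primitive a) (fun _ => lam) 0 1 ψ vψ)
    (hW : ∀ t ∈ Icc (0 : ℝ) 1, wr φ vφ ψ vψ t = W) (hW0 : W ≠ 0)
    (h0 : ∀ u, Bc u → φ 0 * derivWithin u (Icc 0 1) 0 = (vφ 0 - primitive a 0 * φ 0) * u 0)
    (h1 : ∀ u, Bc u → ψ 1 * derivWithin u (Icc 0 1) 1 = (vψ 1 - primitive a 1 * ψ 1) * u 1)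
    {G H : ℝ → ℝ → ℝ} (hG : IsGreenFunction a lam Bc G) (hH : IsGreenFunction a lam Bc H)
    (ht : t ∈ Icc (0 : ℝ) 1) (hs : s ∈ Icc (0 : ℝ) 1) : H t s = G t s := by
  have hsec {K : ℝ → ℝ → ℝ} (hK : IsGreenFunction a lam Bc K) :
      ContinuousOn (fun s => K t s) (Icc 0 1) :=
    hK.continuousOn.comp (f := fun s => (t, s)) (by fun_prop) fun s hs => ⟨ht, hs⟩
  -- The conditions on a Green's function concern interior `s`; continuity extends equality to the
  -- edges.
  suffices heq : EqOn (fun s => H t s) (fun s => G t s) (Ioo 0 1) from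
    heq.of_subset_closure (hsec hH) (hsec hG) Ioo_subset_Icc_self
      (by rw [closure_Ioo zero_ne_one]) hs
  intro s hs
  have hn : Icc (0 : ℝ) 1 ∈ 𝓝 s := Icc_mem_nhds hs.1 hs.2
  obtain ⟨l, r, hl, -, hr, -, hlr⟩ := hG.jump s hs
  obtain ⟨l', r', hl', -, hr', -, hlr'⟩ := hH.jump s hs
  have hcont {K : ℝ → ℝ → ℝ} (hK : IsGreenFunction a lam Bc K) :
      Tendsto (fun t => K t s) (𝓝 s) (𝓝 (K s s)) :=
    (((hK.continuousOn.comp (f := fun t => (t, s)) (by fun_prop)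
      fun t ht => ⟨ht, Ioo_subset_Icc_self hs⟩ : ContinuousOn (fun t => K t s) (Icc 0 1))
      ).continuousAt hn).tendsto
  have hB := ((continuousOn_primitive ha).continuousAt hn).tendsto
  have hd := ((hcont hH).const_mul 1).add ((hcont hG).const_mul (-1))
  have hv {F : Filter ℝ} (hF : F ≤ 𝓝 s) {m m' : ℝ}
      (hm : Tendsto (fun x => partialT G x s) F (𝓝 m))
      (hm' : Tendsto (fun x => partialT H x s) F (𝓝 m')) :=
    ((hm'.add ((hB.mul (hcont hH)).mono_left hF)).const_mul 1).add
      ((hm.add ((hB.mul (hcont hG)).mono_left hF)).const_mul (-1))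
  have hvl := hv nhdsWithin_le_nhds hl hl'
  have hvr := hv nhdsWithin_le_nhds hr hr'
  -- Equal unit jumps cancel, so the difference of the Green's functions has the same one-sided
  -- derivatives at `s`.
  rw [show r' = l' + 1 by linarith, show r = l + 1 by linarith] at hvr
  have key := eq_zero_of_two_sided hφ hψ hW hW0 hs
    (fun c hc => (hH.sysOn_left ha hs hc).linComb (hG.sysOn_left ha hs hc) 1 (-1))
    (fun c hc => (hH.sysOn_right ha hs hc).linComb (hG.sysOn_right ha hs hc) 1 (-1))
    (hd.mono_left nhdsWithin_le_nhds) (hd.mono_left nhdsWithin_le_nhds) hvl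
    (by convert hvr using 2; ring)
    (by
      have g := h0 _ (hG.boundary s hs)
      have h := h0 _ (hH.boundary s hs)
      simp only [wr, partialT]
      linear_combination h - g)
    (by
      have g := h1 _ (hG.boundary s hs)
      have h := h1 _ (hH.boundary s hs)
      simp only [wr, partialT]
      linear_combination h - g) ht
  simp only
  linarith

end Uniqueness

/-! ### Positive solutions below the principal eigenvalue and comparison of the kernels. -/

/-- Below a parameter with a positive Neumann solution there is a positive fundamental system with
Neumann data at either endpoint. -/
theorem exists_positive_pair {B : ℝ → ℝ} {mu lam : ℝ} {y v : ℝ → ℝ}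
    (hB : ContinuousOn B (Icc 0 1)) (hs : SysOn B (fun _ => mu) 0 1 y v)
    (hv : v 0 = 0) (hpos : ∀ t ∈ Icc (0 : ℝ) 1, 0 < y t)
    (hN : v 1 - B 1 * y 1 = 0) (hlt : lam < mu) :
    ∃ φ vφ ψ vψ : ℝ → ℝ, ∃ W : ℝ, SysOn B (fun _ => lam) 0 1 φ vφ ∧
      SysOn B (fun _ => lam) 0 1 ψ vψ ∧ φ 0 = 1 ∧ vφ 0 = 0 ∧ ψ 1 = 1 ∧ vψ 1 = B 1 ∧ W < 0 ∧
      (∀ t ∈ Icc (0 : ℝ) 1, wr φ vφ ψ vψ t = W) ∧ (∀ t ∈ Icc (0 : ℝ) 1, 0 < φ t) ∧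
      (∀ t ∈ Icc (0 : ℝ) 1, 0 < ψ t) ∧ (∀ t ∈ Ioc (0 : ℝ) 1, ψ t < ψ 0 * φ t) ∧
      (∀ t ∈ Ico (0 : ℝ) 1, φ t < φ 1 * ψ t) := by
  have h01 : (0 : ℝ) ∈ Icc (0 : ℝ) 1 := by simp
  have h11 : (1 : ℝ) ∈ Icc (0 : ℝ) 1 := by simp
  obtain ⟨φ, vφ, hφ, hφ0, hvφ0⟩ := exists_sysOn hB (continuousOn_const (c := lam)) 1 0
  obtain ⟨χ, vχ, hχ, hχ0, hvχ0⟩ := exists_sysOn hB (continuousOn_const (c := lam)) 0 1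
  obtain ⟨hφpos, hw⟩ := hs.comparison hφ (fun _ _ => hlt) hpos (by simp [hφ0])
    (by simp [wr, hv, hvφ0])
  have hdφ : 0 < vφ 1 - B 1 * φ 1 := by
    refine pos_of_mul_pos_right (b := vφ 1 - B 1 * φ 1) (a := y 1) ?_ (hpos 1 h11).le
    simp only [wr] at hw
    rw [sub_eq_zero.1 hN] at hw
    linarith
  have hwχ : wr φ vφ χ vχ 1 = 1 := by
    rw [hφ.wr_eq_left hχ h11]; simp [wr, hφ0, hvφ0, hvχ0]
  -- These coefficients are Cramer's rule for `ψ 1 = 1`, `vψ 1 = B 1`, since `φ`, `χ` have Wronskian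
  -- `1`.
  have hψ := hφ.linComb hχ (vχ 1 - B 1 * χ 1) (B 1 * φ 1 - vφ 1)
  set ψ := fun t => (vχ 1 - B 1 * χ 1) * φ t + (B 1 * φ 1 - vφ 1) * χ t
  set vψ := fun t => (vχ 1 - B 1 * χ 1) * vφ t + (B 1 * φ 1 - vφ 1) * vχ t
  simp only [wr] at hwχ
  have hψ1 : ψ 1 = 1 := by simp only [ψ]; linear_combination hwχ
  have hvψ1 : vψ 1 = B 1 := by simp only [vψ]; linear_combination B 1 * hwχ
  have hW : ∀ t ∈ Icc (0 : ℝ) 1, wr φ vφ ψ vψ t = -(vφ 1 - B 1 * φ 1) := fun t ht => by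
    rw [hφ.wr_eq hψ ht h11, wr, hψ1, hvψ1]; ring
  have hanti : StrictAntiOn (fun t => ψ t / φ t) (Icc 0 1) := by
    refine strictAntiOn_of_deriv_neg (convex_Icc _ _)
      (hψ.continuousOn_fst.div hφ.continuousOn_fst fun t ht => (hφpos t ht).ne') fun t ht => ?_
    rw [interior_Icc] at ht
    have ht' := Ioo_subset_Icc_self ht
    rw [((hφ.hasDerivWithinAt_div hψ ht' (hφpos t ht').ne').hasDerivAt
      (Icc_mem_nhds ht.1 ht.2)).deriv, hW t ht']
    exact div_neg_of_neg_of_pos (neg_neg_of_pos hdφ) (pow_pos (hφpos t ht') 2)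
  have hlow : ∀ t ∈ Ico (0 : ℝ) 1, φ t < φ 1 * ψ t := fun t ht => by
    have ht' := Ico_subset_Icc_self ht
    have h := hanti ht' h11 ht.2
    simp only [hψ1] at h
    rw [div_lt_div_iff₀ (hφpos 1 h11) (hφpos t ht')] at h
    linarith
  refine ⟨φ, vφ, ψ, vψ, _, hφ, hψ, hφ0, hvφ0, hψ1, hvψ1, neg_neg_of_pos hdφ, hW, hφpos,
    fun t ht => ?_, fun t ht => ?_, hlow⟩
  · rcases ht.2.eq_or_lt with rfl | h
    · simp [hψ1]
    · exact pos_of_mul_pos_right ((hφpos t ht).trans (hlow t ⟨ht.1, h⟩)) (hφpos 1 h11).le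
  · have h := hanti h01 (Ioc_subset_Icc_self ht) ht.1
    simp only [hφ0, div_one] at h
    rwa [div_lt_iff₀ (hφpos t (Ioc_subset_Icc_self ht))] at h

theorem partialT_eq_derivWithin {G : ℝ → ℝ → ℝ} {t s : ℝ} :
    derivWithin (fun x => G x s) (Icc 0 1) t = partialT G t s := rfl

end HillGreen

open HillGreen in
theorem mainTheorem3 (a : ℝ → ℝ) (ha : IntegrableOn a (Icc (0 : ℝ) 1) volume) :
    ∃ lam0N : ℝ, IsLeast (HillGreen.eigenvalues a HillGreen.NeumannBC) lam0N ∧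
      ∀ lam : ℝ, lam < lam0N →
        ∃ GN GD : ℝ → ℝ → ℝ,
          HillGreen.IsUniqueGreenFunction a lam HillGreen.NeumannBC GN ∧
          HillGreen.IsUniqueGreenFunction a lam HillGreen.DirichletBC GD ∧
          ∀ t ∈ Ioo (0 : ℝ) 1, ∀ s ∈ Ioo (0 : ℝ) 1, GN t s < GD t s ∧ GD t s < 0 := by
  have h01 : (0 : ℝ) ∈ Icc (0 : ℝ) 1 := by simp
  have h11 : (1 : ℝ) ∈ Icc (0 : ℝ) 1 := by simp
  have hB := continuousOn_primitive ha
  have hB0 : primitive a 0 = 0 := primitive_zero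
  obtain ⟨mu, y, v, hs, hy, hv, hpos, hN⟩ := exists_principal hB
  refine ⟨mu, ⟨⟨y, hs.solvesHomogeneous ha one_pos subset_rfl, ⟨?_, ?_⟩, 0, h01, by simp [hy]⟩, ?_⟩,
    ?_⟩
  · rw [hs.derivWithin_fst one_pos h01, hv, hB0]; ring
  · rw [hs.derivWithin_fst one_pos h11, hN]
  · rintro lam ⟨u, hu, ⟨hu0, hu1⟩, t, ht, hne⟩
    by_contra! hlt
    obtain ⟨φ, vφ, ψ, vψ, W, hφ, hψ, hφ0, hvφ0, hψ1, hvψ1, hWneg, hW, -⟩ :=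
      exists_positive_pair hB hs hv hpos hN hlt
    have hsu := hu.sysOn ha one_pos subset_rfl
    -- Shared Neumann data make `u` have zero Wronskian with `φ` (seen at `0`) and with `ψ` (seen at
    -- `1`), so `W * u t = 0`.
    have e1 := hφ.wr_eq_left hsu ht
    have e2 := hψ.wr_eq hsu ht h11
    have e3 := hW t ht
    simp only [wr, hu0, hu1, hφ0, hvφ0, hψ1, hvψ1, hB0] at e1 e2 e3
    refine hne ((mul_eq_zero.1 (?_ : W * u t = 0)).resolve_left hWneg.ne)
    rw [← e3]
    linear_combination ψ t * e1 - φ t * e2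
  · intro lam hlt
    obtain ⟨φ, vφ, ψ, vψ, W, hφ, hψ, hφ0, hvφ0, hψ1, hvψ1, hWneg, hW, hφpos, hψpos, hup, hlow⟩ :=
      exists_positive_pair hB hs hv hpos hN hlt
    have hψ0 := hψpos 0 h01
    have hφ1 := hφpos 1 h11
    set α := (ψ 0)⁻¹
    set β := (φ 1)⁻¹
    have hα0 : 0 < α := inv_pos.2 hψ0
    have hβ0 : 0 < β := inv_pos.2 hφ1
    have hαψ : α * ψ 0 = 1 := inv_mul_cancel₀ hψ0.ne'
    have hβφ : β * φ 1 = 1 := inv_mul_cancel₀ hφ1.ne'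
    have hP := hφ.linComb hψ 1 (-α)
    have hQ := hψ.linComb hφ 1 (-β)
    set P := fun t => 1 * φ t + -α * ψ t
    set Q := fun t => 1 * ψ t + -β * φ t
    set vP := fun t => 1 * vφ t + -α * vψ t
    set vQ := fun t => 1 * vψ t + -β * vφ t
    have hPpos : ∀ t ∈ Ioc (0 : ℝ) 1, 0 < P t := fun t ht => by
      have h := mul_lt_mul_of_pos_left (hup t ht) hα0
      rw [← mul_assoc, hαψ] at h
      simp only [P]; linarith
    have hQpos : ∀ t ∈ Ico (0 : ℝ) 1, 0 < Q t := fun t ht => by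
      have h := mul_lt_mul_of_pos_left (hlow t ht) hβ0
      rw [← mul_assoc, hβφ] at h
      simp only [Q]; linarith
    have hP0 : P 0 = 0 := by simp only [P, hφ0]; linarith
    have hQ1 : Q 1 = 0 := by simp only [Q, hψ1]; linarith
    -- This number is `β * P 1`.
    have hαβ : 0 < 1 - α * β := by
      have h := mul_pos hβ0 (hPpos 1 (by simp))
      simp only [P, hψ1] at h
      linarith
    have hWD : ∀ t ∈ Icc (0 : ℝ) 1, wr P vP Q vQ t = W * (1 - α * β) := fun t ht => by
      rw [← hW t ht]; simp only [wr, P, Q, vP, vQ]; ring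
    have hWD0 : W * (1 - α * β) < 0 := mul_neg_of_neg_of_pos hWneg hαβ
    have hφ' : vφ 0 - primitive a 0 * φ 0 = 0 := by rw [hvφ0, hB0]; ring
    have hψ' : vψ 1 - primitive a 1 * ψ 1 = 0 := by rw [hvψ1, hψ1]; ring
    have hGN : IsGreenFunction a lam NeumannBC (kernel φ ψ W) :=
      isGreenFunction_kernel ha hφ hψ hW hWneg.ne fun s hs => by
        constructor
        · rw [partialT_eq_derivWithin, partialT_kernel_of_lt hφ h01 hs.1, hφ', zero_mul]
        · rw [partialT_eq_derivWithin, partialT_kernel_of_gt hψ h11 hs.2, hψ', zero_mul]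
    have hGD : IsGreenFunction a lam DirichletBC (kernel P Q (W * (1 - α * β))) :=
      isGreenFunction_kernel ha hP hQ hWD hWD0.ne fun s hs => by
        constructor
        · simp only [kernel_of_le hs.1.le, hP0, zero_mul, zero_div]
        · simp only [kernel_of_ge hs.2.le, hQ1, mul_zero, zero_div]
    refine ⟨_, _, ⟨hGN, fun H hH t ht s hs => hGN.unique ha hφ hψ hW hWneg.ne ?_ ?_ hH ht hs⟩,
      ⟨hGD, fun H hH t ht s hs => hGD.unique ha hP hQ hWD hWD0.ne ?_ ?_ hH ht hs⟩, ?_⟩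
    · intro u hu; rw [hu.1, hφ']; ring
    · intro u hu; rw [hu.2, hψ']; ring
    · intro u hu; rw [hu.1, hP0]; ring
    · intro u hu; rw [hu.2, hQ1]; ring
    · have hneg : ∀ t ∈ Ioo (0 : ℝ) 1, ∀ s ∈ Ioo (0 : ℝ) 1,
          φ t * ψ s / W < P t * Q s / (W * (1 - α * β)) ∧ P t * Q s / (W * (1 - α * β)) < 0 := by
        intro t ht s hs
        have hPt := hPpos t (Ioo_subset_Ioc_self ht)
        have hQs := hQpos s (Ioo_subset_Ico_self hs)
        refine ⟨?_, div_neg_of_pos_of_neg (mul_pos hPt hQs) hWD0⟩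
        -- The sum of `h1` and `h2` is exactly the gap between the numerators over the common
        -- negative denominator `W * (1 - α * β)`.
        have h1 := mul_pos (mul_pos hβ0 (hφpos t (Ioo_subset_Icc_self ht)))
          (hPpos s (Ioo_subset_Ioc_self hs))
        have h2 := mul_pos (mul_pos hα0 (hψpos t (Ioo_subset_Icc_self ht))) hQs
        rw [← mul_div_mul_right (φ t * ψ s) W hαβ.ne']
        refine div_lt_div_of_neg_of_lt hWD0 ?_
        simp only [P, Q] at h1 h2 ⊢
        linarith
      intro t ht s hs
      rcases le_total t s with h | h
      · rw [kernel_of_le h, kernel_of_le h]; exact hneg t ht s hs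
      · rw [kernel_of_ge h, kernel_of_ge h]; exact hneg s hs t ht
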